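/- Let $m\in\mathbb N$ and let $X_1,X_2,\dots$ be i.i.d. random matrices with values in the cone $\mathcal P_m$ of real symmetric positive definite $m\times m$ matrices. Assume that the $X_n$ are orthogonally invariant ($kX_nk'$ has the same law as $X_n$ for every orthogonal $k$) and that $\mathbb E X_n=I_m$. Put $S_1=X_1$, $S_{n+1}=S_n^{1/2}X_{n+1}S_n^{1/2}$; let $$d_R(A,B)=\Big(\sum_{j=1}^m\big[\log\lambda_j(A^{-1/2}BA^{-1/2})\big]^2\Big)^{1/2},$$ where $\lambda_1,\dots,\lambda_m$ denote the eigenvalues, and $$M_n=\max_{1\le j\le n}d_R(I_m,X_j),\qquad U_n=\max_{1\le j\le n}d_R(I_m,S_j).$$ A sequence $(Y_n)$ of random elements of a finite-dimensional Euclidean space is called a martingale if $\mathbb E\|Y_n\|<\infty$ and $\mathbb E(Y_{n+1}\mid Y_1,\dots,Y_n)=Y_n$ almost surely for all $n\ge1$. A real sequence $(Y_n)$ is called a submartingale if $\mathbb E|Y_n|<\infty$ and $\mathbb E(Y_{n+1}\mid Y_1,\dots,Y_n)\ge Y_n$ almost surely for all $n\ge1$. Then: 1. $(S_n)$ is a martingale.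 2. If $\mathbb E\,d_R(I_m,X_1)<\infty$, then $(M_n)$ and $(U_n)$ are submartingales. Conversely, if $(M_n)$ or $(U_n)$ is a submartingale, then $\mathbb E\,d_R(I_m,X_1)<\infty$. 3. $(M_n)$ and $(U_n)$ are nonnegative and nondecreasing. Hence, for $Y=M$ or $Y=U$, all $n\ge1$ and all $t>0$, the event $\{\max_{i\le n}Y_i\ge t\}$ of Kolmogorov's inequality equals the event $\{Y_n\ge t\}$ of Markov's inequality, and $\mathbb P(Y_n\ge t)\le t^{-1}\,\mathbb E(Y_n)$, with $\mathbb E(Y_n)\in[0,\infty]$. -/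

import Mathlib

open MeasureTheory ProbabilityTheory
open scoped ENNReal Matrix Matrix.Norms.L2Operator MatrixOrder

/-- The Borel σ-algebra on real `m × m` matrices. The norm in force on matrices is the spectral
(`ℓ²` operator) norm; its topology is the usual entrywise one. -/
instance instMeasurableSpaceRealMatrix (m : ℕ) :
    MeasurableSpace (Matrix (Fin m) (Fin m) ℝ) := borel _

instance instBorelSpaceRealMatrix (m : ℕ) : BorelSpace (Matrix (Fin m) (Fin m) ℝ) := ⟨rfl⟩

/-- The composition `A ∘ B = A^{1/2} B A^{1/2}` on the cone of positive definite matrices. -/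
noncomputable def coneMul {m : ℕ} (A B : Matrix (Fin m) (Fin m) ℝ) :
    Matrix (Fin m) (Fin m) ℝ :=
  CFC.sqrt A * B * CFC.sqrt A

/-- The Riemannian distance `d_R(A, B) = (∑ⱼ (log λⱼ(A^{-1/2} B A^{-1/2}))²)^{1/2}`. The
eigenvalues, with multiplicity, are the roots of the characteristic polynomial. -/
noncomputable def riemannDist {m : ℕ} (A B : Matrix (Fin m) (Fin m) ℝ) : ℝ :=
  Real.sqrt ((((CFC.sqrt A)⁻¹ * B * (CFC.sqrt A)⁻¹).charpoly.roots.map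
    fun l => (Real.log l) ^ 2).sum)

/-- A random matrix `X` is orthogonally invariant when `X` and `k X k'` have the same law for
every orthogonal matrix `k`. -/
def OrthogonallyInvariant {Ω : Type*} [MeasurableSpace Ω] (μ : Measure Ω) {m : ℕ}
    (X : Ω → Matrix (Fin m) (Fin m) ℝ) : Prop :=
  ∀ k ∈ Matrix.orthogonalGroup (Fin m) ℝ,
    IdentDistrib (fun ω => k * X ω * kᵀ) X μ μ

/-- Partial products of the random walk. Time starts at `0`: `X n` and `partialProduct X n` are
the `(n + 1)`-st step and the `(n + 1)`-st partial product. -/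
noncomputable def partialProduct {Ω : Type*} {m : ℕ}
    (X : ℕ → Ω → Matrix (Fin m) (Fin m) ℝ) : ℕ → Ω → Matrix (Fin m) (Fin m) ℝ
  | 0 => X 0
  | n + 1 => fun ω => coneMul (partialProduct X n ω) (X (n + 1) ω)

/-- `max {f 0, …, f n}`. -/
def runningMax (f : ℕ → ℝ) (n : ℕ) : ℝ :=
  (Finset.range (n + 1)).sup' Finset.nonempty_range_add_one f

/-- The largest distance `d_R(I, X j)` of a step up to time `n`. -/
noncomputable def maxStepDist {Ω : Type*} {m : ℕ}
    (X : ℕ → Ω → Matrix (Fin m) (Fin m) ℝ) (n : ℕ) (ω : Ω) : ℝ :=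
  runningMax (fun j => riemannDist 1 (X j ω)) n

/-- The largest distance `d_R(I, S j)` of a partial product up to time `n`. -/
noncomputable def maxWalkDist {Ω : Type*} {m : ℕ}
    (X : ℕ → Ω → Matrix (Fin m) (Fin m) ℝ) (n : ℕ) (ω : Ω) : ℝ :=
  runningMax (fun j => riemannDist 1 (partialProduct X j ω)) n

/-- `Y` is a sequence of integrable random elements with `E(Y (n+1) | Y 0, …, Y n) = Y n`:
a martingale for the filtration generated by `Y` itself. -/
def IsMartingaleSeq {Ω E : Type*} [MeasurableSpace Ω] [NormedAddCommGroup E] [NormedSpace ℝ E]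
    [CompleteSpace E] [MeasurableSpace E] [BorelSpace E] (μ : Measure Ω) (Y : ℕ → Ω → E) : Prop :=
  ∃ h : ∀ n, StronglyMeasurable (Y n), Martingale Y (Filtration.natural Y h) μ

/-- `Y` is a sequence of integrable real random variables with
`E(Y (n+1) | Y 0, …, Y n) ≥ Y n`: a submartingale for the filtration generated by `Y` itself. -/
def IsSubmartingaleSeq {Ω : Type*} [MeasurableSpace Ω] (μ : Measure Ω) (Y : ℕ → Ω → ℝ) : Prop :=
  ∃ h : ∀ n, StronglyMeasurable (Y n), Submartingale Y (Filtration.natural Y h) μ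

/-- The process `Y` is nonnegative and nondecreasing, so that the event
`max {Y 0, …, Y n} ≥ t` of Kolmogorov's inequality is the event `Y n ≥ t` of Markov's inequality,
and the bound `P(Y n ≥ t) ≤ E(Y n) / t` holds for `t > 0`. The expectation of a nonnegative
variable is taken in `[0, ∞]`. -/
def KolmogorovReducesToMarkov {Ω : Type*} [MeasurableSpace Ω] (μ : Measure Ω)
    (Y : ℕ → Ω → ℝ) : Prop :=
  (∀ ω n, 0 ≤ Y n ω) ∧ (∀ ω, Monotone fun n => Y n ω) ∧
  ∀ (n : ℕ) (t : ℝ), 0 < t →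
    {ω | t ≤ runningMax (fun i => Y i ω) n} = {ω | t ≤ Y n ω} ∧
    μ {ω | t ≤ Y n ω} ≤ (∫⁻ ω, ENNReal.ofReal (Y n ω) ∂μ) / ENNReal.ofReal t

/-! ### Powers and logarithms of positive definite matrices -/

section PositiveDefinite

variable {m : ℕ} {A B : Matrix (Fin m) (Fin m) ℝ}

/-! The past of `S` is contained in the past of `X`, hence is independent of the next step. Both
factors `S_n^{1/2}` leave the conditional expectation (`condExp_coneMul`), and mean `1` leaves
`S_n^{1/2} S_n^{1/2} = S_n`. Integrability follows from `norm_coneMul_le` and independence.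

A running maximum is monotone in time, so it is a submartingale exactly when it is integrable; at
time `0` both maxima equal `d_R(I, X 0)`, which gives the converse. Integrability of the walk
distance needs no triangle inequality: with `d = d_R(I, A)` one has `e^{-d} ≤ A ≤ e^d`, such scalar
bounds multiply under `coneMul`, and they return a distance bound at the cost of a factor `√m`. -/

theorem isUnit_sqrt_of_posDef (hA : A.PosDef) : IsUnit (CFC.sqrt A) := by
  have h := hA.isUnit
  rw [← CFC.sqrt_mul_sqrt_self A hA.posSemidef.nonneg] at h
  exact (Commute.isUnit_mul_iff rfl).1 h |>.1

theorem posDef_coneMul (hA : A.PosDef) (hB : B.PosDef) : (coneMul A B).PosDef := by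
  have h : (CFC.sqrt A)ᴴ = CFC.sqrt A := (CFC.sqrt_nonneg A).isSelfAdjoint
  have := (Matrix.IsUnit.posDef_star_left_conjugate_iff (isUnit_sqrt_of_posDef hA)).2 hB
  rwa [Matrix.star_eq_conjTranspose, h] at this

theorem norm_coneMul_le (hA : 0 ≤ A) : ‖coneMul A B‖ ≤ ‖A‖ * ‖B‖ := by
  have h : ‖CFC.sqrt A‖ * ‖CFC.sqrt A‖ = ‖A‖ := by
    rw [CFC.norm_sqrt A hA, Real.mul_self_sqrt (norm_nonneg A)]
  calc ‖coneMul A B‖ ≤ ‖CFC.sqrt A‖ * ‖B‖ * ‖CFC.sqrt A‖ := norm_mul₃_le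
    _ = ‖A‖ * ‖B‖ := by rw [← h]; ring

/-- Conjugating `B ≤ b` by `A^{1/2}` gives `b A`, and `b A ≤ b a` since `b ≥ 0`. -/
theorem coneMul_le_algebraMap (hA : 0 ≤ A) {a b : ℝ} (hb : 0 ≤ b)
    (hAa : A ≤ algebraMap ℝ _ a) (hBb : B ≤ algebraMap ℝ _ b) :
    coneMul A B ≤ algebraMap ℝ _ (b * a) := by
  refine (conjugate_le_conjugate_of_nonneg hBb (CFC.sqrt_nonneg A)).trans ?_
  rw [← Algebra.commutes, mul_assoc, CFC.sqrt_mul_sqrt_self A hA, map_mul, ← Algebra.smul_def,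
    ← Algebra.smul_def]
  exact smul_le_smul_of_nonneg_left hAa hb

theorem algebraMap_le_coneMul (hA : 0 ≤ A) {a b : ℝ} (hb : 0 ≤ b)
    (hAa : algebraMap ℝ _ a ≤ A) (hBb : algebraMap ℝ _ b ≤ B) :
    algebraMap ℝ _ (b * a) ≤ coneMul A B := by
  refine le_trans ?_ (conjugate_le_conjugate_of_nonneg hBb (CFC.sqrt_nonneg A))
  rw [← Algebra.commutes, mul_assoc, CFC.sqrt_mul_sqrt_self A hA, map_mul, ← Algebra.smul_def,
    ← Algebra.smul_def]
  exact smul_le_smul_of_nonneg_left hAa hb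

theorem riemannDist_one_eq_sum (hA : A.IsHermitian) :
    riemannDist 1 A = √(∑ i, Real.log (hA.eigenvalues i) ^ 2) := by
  simp [riemannDist, CFC.sqrt_one, hA.roots_charpoly_eq_eigenvalues, Function.comp_def,
    List.sum_ofFn]

/-- The functional calculus depends continuously on `A`, so this form yields continuity of the
distance without tracking individual eigenvalues. -/
theorem riemannDist_one_eq_trace (hA : A.IsHermitian) :
    riemannDist 1 A = √(cfc (fun x => Real.log x ^ 2) A).trace := by
  rw [riemannDist_one_eq_sum hA, hA.cfc_eq, Matrix.IsHermitian.cfc,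
    Unitary.conjStarAlgAut_apply, Matrix.trace_mul_comm, ← mul_assoc]
  simp [Matrix.trace]

theorem riemannDist_nonneg (A B : Matrix (Fin m) (Fin m) ℝ) : 0 ≤ riemannDist A B :=
  Real.sqrt_nonneg _

theorem abs_log_eigenvalues_le_riemannDist (hA : A.IsHermitian) (i : Fin m) :
    |Real.log (hA.eigenvalues i)| ≤ riemannDist 1 A := by
  rw [riemannDist_one_eq_sum hA]
  exact Real.abs_le_sqrt (Finset.single_le_sum
    (f := fun i => Real.log (hA.eigenvalues i) ^ 2) (fun i _ => sq_nonneg _) (Finset.mem_univ i))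

theorem le_exp_riemannDist (hA : A.PosDef) :
    A ≤ algebraMap ℝ _ (Real.exp (riemannDist 1 A)) := by
  refine (le_algebraMap_iff_spectrum_le hA.isHermitian).2 fun x hx => ?_
  rw [hA.isHermitian.spectrum_real_eq_range_eigenvalues] at hx
  obtain ⟨i, rfl⟩ := hx
  rw [← Real.log_le_iff_le_exp (hA.eigenvalues_pos i)]
  exact (abs_le.1 (abs_log_eigenvalues_le_riemannDist hA.isHermitian i)).2

theorem exp_neg_riemannDist_le (hA : A.PosDef) :
    algebraMap ℝ _ (Real.exp (-riemannDist 1 A)) ≤ A := by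
  refine (algebraMap_le_iff_le_spectrum hA.isHermitian).2 fun x hx => ?_
  rw [hA.isHermitian.spectrum_real_eq_range_eigenvalues] at hx
  obtain ⟨i, rfl⟩ := hx
  rw [← Real.le_log_iff_exp_le (hA.eigenvalues_pos i)]
  exact (abs_le.1 (abs_log_eigenvalues_le_riemannDist hA.isHermitian i)).1

theorem riemannDist_one_le_of_exp_bounds (hA : A.PosDef) {c : ℝ} (hc : 0 ≤ c)
    (hlower : algebraMap ℝ _ (Real.exp (-c)) ≤ A) (hupper : A ≤ algebraMap ℝ _ (Real.exp c)) :
    riemannDist 1 A ≤ √m * c := by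
  rw [algebraMap_le_iff_le_spectrum hA.isHermitian] at hlower
  rw [le_algebraMap_iff_spectrum_le hA.isHermitian] at hupper
  rw [riemannDist_one_eq_sum hA.isHermitian, ← Real.sqrt_sq hc, ← Real.sqrt_mul m.cast_nonneg]
  refine Real.sqrt_le_sqrt ?_
  calc ∑ i, Real.log (hA.isHermitian.eigenvalues i) ^ 2 ≤ ∑ _i : Fin m, c ^ 2 := by
        refine Finset.sum_le_sum fun i _ => sq_le_sq.2 ?_
        have hi := hA.isHermitian.eigenvalues_mem_spectrum_real i
        rw [abs_of_nonneg hc, abs_le, Real.le_log_iff_exp_le (hA.eigenvalues_pos i),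
          Real.log_le_iff_le_exp (hA.eigenvalues_pos i)]
        exact ⟨hlower _ hi, hupper _ hi⟩
    _ = m * c ^ 2 := by simp

end PositiveDefinite

/-! ### Measurability -/

section Measurability

variable {Ω : Type*} {m : ℕ}

instance secondCountableTopologyRealMatrix (m : ℕ) :
    SecondCountableTopology (Matrix (Fin m) (Fin m) ℝ) :=
  secondCountable_of_proper (α := Matrix (Fin m) (Fin m) ℝ)

/-- The square root and the distance are controlled only on a cone; factoring through the subtype
avoids extending them. -/
theorem ContinuousOn.measurable_comp_of_forall_mem {α β γ : Type*} [MeasurableSpace α]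
    [TopologicalSpace β] [MeasurableSpace β] [OpensMeasurableSpace β] [TopologicalSpace γ]
    [MeasurableSpace γ] [BorelSpace γ] {s : Set β} {f : β → γ} {g : α → β}
    (hf : ContinuousOn f s) (hg : Measurable g) (hgs : ∀ x, g x ∈ s) :
    Measurable fun x => f (g x) :=
  (continuousOn_iff_continuous_domRestrict.1 hf).measurable.comp (hg.subtype_mk (h := hgs))

theorem measurable_sqrt_comp [MeasurableSpace Ω] {A : Ω → Matrix (Fin m) (Fin m) ℝ}
    (hA : Measurable A) (hpos : ∀ ω, (A ω).PosDef) : Measurable fun ω => CFC.sqrt (A ω) :=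
  CFC.continuousOn_sqrt.measurable_comp_of_forall_mem hA fun ω => (hpos ω).posSemidef.nonneg

theorem measurable_coneMul [MeasurableSpace Ω] {A B : Ω → Matrix (Fin m) (Fin m) ℝ}
    (hA : Measurable A) (hpos : ∀ ω, (A ω).PosDef) (hB : Measurable B) :
    Measurable fun ω => coneMul (A ω) (B ω) :=
  ((measurable_sqrt_comp hA hpos).mul hB).mul (measurable_sqrt_comp hA hpos)

theorem continuousOn_riemannDist_one :
    ContinuousOn (riemannDist (1 : Matrix (Fin m) (Fin m) ℝ)) {A | A.PosDef} := by
  have h : ContinuousOn (fun A : Matrix (Fin m) (Fin m) ℝ => cfc (fun x => Real.log x ^ 2) A)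
      {A | A.PosDef} := by
    refine ContinuousOn.cfc_of_mem_nhdsSet (s := Set.Ioi 0) _ ?_ continuousOn_id
      (fun A hA => Matrix.PosDef.isHermitian hA)
      ((Real.continuousOn_log.mono fun x hx => ne_of_gt hx).pow 2)
    -- The spectra stay in the open half-line, where `log ^ 2` is continuous.
    refine isOpen_Ioi.mem_nhdsSet.2 (Set.iUnion₂_subset fun A hA x hx => ?_)
    rw [(Matrix.PosDef.isHermitian hA).spectrum_real_eq_range_eigenvalues] at hx
    obtain ⟨i, rfl⟩ := hx
    exact Matrix.PosDef.eigenvalues_pos hA i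
  refine (Real.continuous_sqrt.comp_continuousOn
    ((Continuous.matrix_trace continuous_id).comp_continuousOn h)).congr fun A hA => ?_
  exact riemannDist_one_eq_trace (Matrix.PosDef.isHermitian hA)

theorem isClosed_posSemidef : IsClosed {A : Matrix (Fin m) (Fin m) ℝ | A.PosSemidef} := by
  simp only [Matrix.posSemidef_iff_dotProduct_mulVec, Set.ofPred_and, Set.ofPred_forall]
  refine (isClosed_eq (Continuous.matrix_conjTranspose continuous_id) continuous_id).inter
    (isClosed_iInter fun x => isClosed_le continuous_const ?_)
  exact continuous_const.dotProduct (Continuous.matrix_mulVec continuous_id continuous_const)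

theorem measurableSet_posDef : MeasurableSet {A : Matrix (Fin m) (Fin m) ℝ | A.PosDef} := by
  have h : {A : Matrix (Fin m) (Fin m) ℝ | A.PosDef} = {A | A.PosSemidef} ∩ {A | A.det ≠ 0} := by
    ext A
    refine ⟨fun hA => ⟨hA.posSemidef, hA.det_pos.ne'⟩, fun hA => ?_⟩
    exact hA.1.posDef_iff_det_ne_zero.2 hA.2
  rw [h]
  exact isClosed_posSemidef.measurableSet.inter
    (isOpen_ne_fun (Continuous.matrix_det continuous_id) continuous_const).measurableSet

theorem measurable_riemannDist_one [MeasurableSpace Ω] {A : Ω → Matrix (Fin m) (Fin m) ℝ}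
    (hA : Measurable A) (hpos : ∀ ω, (A ω).PosDef) : Measurable fun ω => riemannDist 1 (A ω) :=
  continuousOn_riemannDist_one.measurable_comp_of_forall_mem hA hpos

end Measurability

/-! ### Running maxima -/

section RunningMax

variable {Ω : Type*} [MeasurableSpace Ω] {μ : Measure Ω}

theorem le_runningMax (f : ℕ → ℝ) {i n : ℕ} (h : i ≤ n) : f i ≤ runningMax f n :=
  Finset.le_sup' f (Finset.mem_range.2 (Nat.lt_succ_of_le h))

theorem runningMax_le {f : ℕ → ℝ} {n : ℕ} {c : ℝ} (h : ∀ i ≤ n, f i ≤ c) :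
    runningMax f n ≤ c :=
  Finset.sup'_le _ _ fun i hi => h i (Nat.le_of_lt_succ (Finset.mem_range.1 hi))

theorem monotone_runningMax (f : ℕ → ℝ) : Monotone (runningMax f) := fun _ _ h =>
  runningMax_le fun _ hi => le_runningMax f (hi.trans h)

theorem runningMax_eq_of_monotone {f : ℕ → ℝ} (hf : Monotone f) (n : ℕ) :
    runningMax f n = f n :=
  le_antisymm (runningMax_le fun _ hi => hf hi) (le_runningMax f le_rfl)

theorem runningMax_zero (f : ℕ → ℝ) : runningMax f 0 = f 0 := by
  simp [runningMax]

theorem runningMax_le_sum {f : ℕ → ℝ} (hf : ∀ i, 0 ≤ f i) (n : ℕ) :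
    runningMax f n ≤ ∑ i ∈ Finset.range (n + 1), f i :=
  runningMax_le fun _ hi => Finset.single_le_sum (fun i _ => hf i)
    (Finset.mem_range.2 (Nat.lt_succ_of_le hi))

theorem measurable_runningMax {f : ℕ → Ω → ℝ} (hf : ∀ i, Measurable (f i)) (n : ℕ) :
    Measurable fun ω => runningMax (fun i => f i ω) n := by
  have h := Finset.measurable_sup' (Finset.nonempty_range_add_one (n := n))
    fun i _ => hf i
  convert h using 1
  ext ω
  simp only [runningMax, Finset.sup'_apply]

theorem integrable_runningMax {f : ℕ → Ω → ℝ} (hf : ∀ i, Measurable (f i))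
    (hnonneg : ∀ i ω, 0 ≤ f i ω) (hint : ∀ i, Integrable (f i) μ) (n : ℕ) :
    Integrable (fun ω => runningMax (fun i => f i ω) n) μ := by
  refine (integrable_finsetSum (Finset.range (n + 1)) fun i _ => hint i).mono'
    (measurable_runningMax hf n).aestronglyMeasurable (.of_forall fun ω => ?_)
  rw [Real.norm_of_nonneg ((hnonneg 0 ω).trans (le_runningMax (fun i => f i ω) n.zero_le))]
  exact runningMax_le_sum (fun i => hnonneg i ω) n

theorem isSubmartingaleSeq_of_monotone [IsFiniteMeasure μ] {Y : ℕ → Ω → ℝ}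
    (hmeas : ∀ n, Measurable (Y n)) (hmono : ∀ ω, Monotone fun n => Y n ω)
    (hint : ∀ n, Integrable (Y n) μ) : IsSubmartingaleSeq μ Y := by
  refine ⟨fun n => (hmeas n).stronglyMeasurable,
    submartingale_nat (Filtration.stronglyAdapted_natural _) hint fun n => ?_⟩
  have h := condExp_mono (m := Filtration.natural Y (fun n => (hmeas n).stronglyMeasurable) n)
    (hint n) (hint (n + 1)) (.of_forall fun ω => hmono ω n.le_succ)
  rwa [condExp_of_stronglyMeasurable (Filtration.le _ n)
    (Filtration.stronglyAdapted_natural _ n) (hint n)] at h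

theorem isSubmartingaleSeq_runningMax_iff [IsFiniteMeasure μ] {f : ℕ → Ω → ℝ}
    (hf : ∀ i, Measurable (f i)) (hnonneg : ∀ i ω, 0 ≤ f i ω)
    (hint : Integrable (f 0) μ → ∀ i, Integrable (f i) μ) :
    IsSubmartingaleSeq μ (fun n ω => runningMax (fun i => f i ω) n) ↔ Integrable (f 0) μ := by
  refine ⟨fun ⟨_, h⟩ => ?_, fun h => isSubmartingaleSeq_of_monotone (measurable_runningMax hf)
    (fun ω => monotone_runningMax _) (integrable_runningMax hf hnonneg (hint h))⟩
  -- At time `0` the maximum has a single term.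
  simpa only [runningMax_zero] using h.integrable 0

theorem kolmogorovReducesToMarkov_runningMax {f : ℕ → Ω → ℝ}
    (hf : ∀ i, Measurable (f i)) (hnonneg : ∀ i ω, 0 ≤ f i ω) :
    KolmogorovReducesToMarkov μ (fun n ω => runningMax (fun i => f i ω) n) := by
  refine ⟨fun ω n => (hnonneg 0 ω).trans (le_runningMax (fun i => f i ω) n.zero_le),
    fun ω => monotone_runningMax _, fun n t ht => ⟨?_, ?_⟩⟩
  · simp only [runningMax_eq_of_monotone (monotone_runningMax _)]
  · refine le_trans (measure_mono fun ω hω => ?_) (meas_ge_le_lintegral_div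
      (measurable_runningMax hf n).ennreal_ofReal.aemeasurable
      (ENNReal.ofReal_pos.2 ht).ne' ENNReal.ofReal_ne_top)
    exact ENNReal.ofReal_le_ofReal hω

end RunningMax

/-! ### The random walk -/

section Walk

variable {Ω : Type*} {m : ℕ} {X : ℕ → Ω → Matrix (Fin m) (Fin m) ℝ}

theorem posDef_partialProduct (hpos : ∀ n ω, (X n ω).PosDef) (n : ℕ) (ω : Ω) :
    (partialProduct X n ω).PosDef := by
  induction n with
  | zero => exact hpos 0 ω
  | succ n ih => exact posDef_coneMul ih (hpos (n + 1) ω)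

theorem measurable_partialProduct [MeasurableSpace Ω] (hpos : ∀ n ω, (X n ω).PosDef) (n : ℕ)
    (hX : ∀ j ≤ n, Measurable (X j)) : Measurable (partialProduct X n) := by
  induction n with
  | zero => exact hX 0 le_rfl
  | succ n ih =>
    exact measurable_coneMul (ih fun j hj => hX j (hj.trans n.le_succ))
      (posDef_partialProduct hpos n) (hX (n + 1) le_rfl)

theorem exp_bounds_partialProduct (hpos : ∀ n ω, (X n ω).PosDef) (n : ℕ) (ω : Ω) :
    algebraMap ℝ _ (Real.exp (-∑ j ∈ Finset.range (n + 1), riemannDist 1 (X j ω))) ≤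
        partialProduct X n ω ∧
      partialProduct X n ω ≤
        algebraMap ℝ _ (Real.exp (∑ j ∈ Finset.range (n + 1), riemannDist 1 (X j ω))) := by
  induction n with
  | zero =>
    have h : partialProduct X 0 = X 0 := rfl
    rw [zero_add, Finset.sum_range_one, h]
    exact ⟨exp_neg_riemannDist_le (hpos 0 ω), le_exp_riemannDist (hpos 0 ω)⟩
  | succ n ih =>
    have hS := (posDef_partialProduct hpos n ω).posSemidef.nonneg
    -- The factor of the new step must come first, to match the product `b * a` in the `coneMul`
    -- bounds.
    rw [Finset.sum_range_succ _ (n + 1), neg_add_rev, Real.exp_add,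
      add_comm (∑ j ∈ Finset.range (n + 1), _), Real.exp_add]
    exact ⟨algebraMap_le_coneMul hS (Real.exp_nonneg _) ih.1 (exp_neg_riemannDist_le (hpos _ ω)),
      coneMul_le_algebraMap hS (Real.exp_nonneg _) ih.2 (le_exp_riemannDist (hpos _ ω))⟩

theorem riemannDist_partialProduct_le (hpos : ∀ n ω, (X n ω).PosDef) (n : ℕ) (ω : Ω) :
    riemannDist 1 (partialProduct X n ω) ≤
      √m * ∑ j ∈ Finset.range (n + 1), riemannDist 1 (X j ω) :=
  riemannDist_one_le_of_exp_bounds (posDef_partialProduct hpos n ω)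
    (Finset.sum_nonneg fun _ _ => riemannDist_nonneg _ _)
    (exp_bounds_partialProduct hpos n ω).1 (exp_bounds_partialProduct hpos n ω).2

variable [MeasurableSpace Ω] {μ : Measure Ω}

theorem integrable_riemannDist_partialProduct (hmeas : ∀ n, Measurable (X n))
    (hpos : ∀ n ω, (X n ω).PosDef) (hint : ∀ n, Integrable (fun ω => riemannDist 1 (X n ω)) μ)
    (n : ℕ) : Integrable (fun ω => riemannDist 1 (partialProduct X n ω)) μ := by
  refine ((integrable_finsetSum (Finset.range (n + 1)) fun i _ => hint i).const_mul √m).mono'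
    (measurable_riemannDist_one (measurable_partialProduct hpos n fun j _ => hmeas j)
      (posDef_partialProduct hpos n)).aestronglyMeasurable (.of_forall fun ω => ?_)
  rw [Real.norm_of_nonneg (riemannDist_nonneg _ _)]
  exact riemannDist_partialProduct_le hpos n ω

theorem integrable_riemannDist_of_identDistrib (hpos : ∀ n ω, (X n ω).PosDef)
    (hident : ∀ n, IdentDistrib (X n) (X 0) μ μ)
    (hint : Integrable (fun ω => riemannDist 1 (X 0 ω)) μ) (n : ℕ) :
    Integrable (fun ω => riemannDist 1 (X n ω)) μ := by
  classical
  let s := {A : Matrix (Fin m) (Fin m) ℝ | A.PosDef}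
  -- Equality of laws transfers through a function measurable on all matrices, so the distance is
  -- set to `0` off the cone.
  have hu : Measurable (s.piecewise (riemannDist 1) fun _ => 0) :=
    continuousOn_riemannDist_one.measurable_piecewise continuousOn_const measurableSet_posDef
  have hu' k : s.piecewise (riemannDist 1) (fun _ => 0) ∘ X k =
      fun ω => riemannDist 1 (X k ω) :=
    funext fun ω => Set.piecewise_eq_of_mem _ _ _ (hpos k ω)
  have h := (hident n).comp hu
  rw [hu', hu'] at h
  exact h.integrable_iff.2 hint

theorem comap_partialProduct_le (hmeas : ∀ n, Measurable (X n)) (hpos : ∀ n ω, (X n ω).PosDef)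
    (hS : ∀ n, StronglyMeasurable (partialProduct X n)) (n : ℕ) :
    (Filtration.natural (partialProduct X) hS n : MeasurableSpace Ω) ≤
      Filtration.natural X (fun n => (hmeas n).stronglyMeasurable) n := by
  refine iSup₂_le fun j hj => Measurable.comap_le ?_
  -- Measurability is applied with the σ-algebra of the steps up to time `n` in place of the ambient
  -- one.
  refine @measurable_partialProduct Ω m X (Filtration.natural X _ n) hpos j fun i hi => ?_
  exact (Filtration.stronglyAdapted_natural
    (fun n => (hmeas n).stronglyMeasurable) i).measurable.mono
    (Filtration.mono _ (hi.trans hj)) le_rfl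

theorem indep_natural_partialProduct (hmeas : ∀ n, Measurable (X n))
    (hpos : ∀ n ω, (X n ω).PosDef) (hindep : iIndepFun X μ)
    (hS : ∀ n, StronglyMeasurable (partialProduct X n)) (n : ℕ) :
    Indep (MeasurableSpace.comap (X (n + 1)) inferInstance)
      (Filtration.natural (partialProduct X) hS n) μ :=
  indep_of_indep_of_le_right (hindep.indep_comap_natural_of_lt
    (fun n => (hmeas n).stronglyMeasurable) n.lt_succ_self)
    (comap_partialProduct_le hmeas hpos hS n)

theorem integrable_partialProduct (hmeas : ∀ n, Measurable (X n))
    (hpos : ∀ n ω, (X n ω).PosDef) (hindep : iIndepFun X μ) (hint : ∀ n, Integrable (X n) μ)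
    (n : ℕ) : Integrable (partialProduct X n) μ := by
  have hS n := measurable_partialProduct hpos n fun j _ => hmeas j
  induction n with
  | zero => exact hint 0
  | succ n ih =>
    have hind : IndepFun (X (n + 1)) (partialProduct X n) μ :=
      indep_of_indep_of_le_right (indep_natural_partialProduct hmeas hpos hindep
        (fun n => (hS n).stronglyMeasurable) n)
        (Filtration.stronglyAdapted_natural
          (fun n => (hS n).stronglyMeasurable) n).measurable.comap_le
    -- Independent integrable norms have an integrable product, which dominates the norm of the next
    -- partial product.
    have hind' : IndepFun (fun ω => ‖partialProduct X n ω‖) (fun ω => ‖X (n + 1) ω‖) μ :=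
      hind.symm.comp measurable_norm measurable_norm
    refine (hind'.integrable_mul ih.norm (hint (n + 1)).norm).mono'
      (hS (n + 1)).aestronglyMeasurable (.of_forall fun ω => ?_)
    exact norm_coneMul_le (posDef_partialProduct hpos n ω).posSemidef.nonneg

/-- The operator `B ↦ A^{1/2} B A^{1/2}` is an `m'`-measurable random linear map, and applying a
linear map to a matrix is bilinear, so the pull-out property for bilinear pairings applies. -/
theorem condExp_coneMul {A B : Ω → Matrix (Fin m) (Fin m) ℝ} {m' : MeasurableSpace Ω}
    (hA : Measurable[m'] A) (hpos : ∀ ω, (A ω).PosDef) (hB : Integrable B μ)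
    (hAB : Integrable (fun ω => coneMul (A ω) (B ω)) μ) :
    μ[fun ω => coneMul (A ω) (B ω) | m'] =ᵐ[μ] fun ω => coneMul (A ω) (μ[B | m'] ω) := by
  have hsqrt : StronglyMeasurable[m'] fun ω => CFC.sqrt (A ω) :=
    (@measurable_sqrt_comp Ω m m' A hA hpos).stronglyMeasurable
  have hcont : Continuous fun M : Matrix (Fin m) (Fin m) ℝ =>
      ContinuousLinearMap.mulLeftRight ℝ (Matrix (Fin m) (Fin m) ℝ) M M :=
    (ContinuousLinearMap.continuous _).clm_apply continuous_id
  exact condExp_bilin_of_stronglyMeasurable_left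
    (ContinuousLinearMap.id ℝ (Matrix (Fin m) (Fin m) ℝ →L[ℝ] Matrix (Fin m) (Fin m) ℝ))
    (hcont.comp_stronglyMeasurable hsqrt) hAB hB

theorem isMartingaleSeq_partialProduct [IsProbabilityMeasure μ] (hmeas : ∀ n, Measurable (X n))
    (hpos : ∀ n ω, (X n ω).PosDef) (hindep : iIndepFun X μ) (hint : ∀ n, Integrable (X n) μ)
    (hmean : ∀ n, ∫ ω, X n ω ∂μ = 1) : IsMartingaleSeq μ (partialProduct X) := by
  have hS n : StronglyMeasurable (partialProduct X n) :=
    (measurable_partialProduct hpos n fun j _ => hmeas j).stronglyMeasurable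
  have hSint := integrable_partialProduct hmeas hpos hindep hint
  refine ⟨hS, martingale_nat (Filtration.stronglyAdapted_natural hS) hSint fun n => ?_⟩
  have hmean' := condExp_indep_eq (hmeas (n + 1)).comap_le (Filtration.le _ n)
    (comap_measurable (X (n + 1))).stronglyMeasurable
    (indep_natural_partialProduct hmeas hpos hindep hS n)
  have hpull := condExp_coneMul (Filtration.stronglyAdapted_natural hS n).measurable
    (posDef_partialProduct hpos n) (hint (n + 1)) (hSint (n + 1))
  filter_upwards [hpull, hmean'] with ω h₁ h₂
  refine Eq.symm (h₁.trans ?_)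
  rw [h₂, hmean, coneMul, mul_one,
    CFC.sqrt_mul_sqrt_self _ (posDef_partialProduct hpos n ω).posSemidef.nonneg]

end Walk

theorem propositionA1 {Ω : Type*} [MeasurableSpace Ω] (μ : Measure Ω) [IsProbabilityMeasure μ]
    (m : ℕ) (X : ℕ → Ω → Matrix (Fin m) (Fin m) ℝ)
    (hmeas : ∀ n, Measurable (X n))
    (hpos : ∀ n ω, (X n ω).PosDef)
    (hindep : iIndepFun X μ)
    (hident : ∀ n, IdentDistrib (X n) (X 0) μ μ)
    (hinv : ∀ n, OrthogonallyInvariant μ (X n))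
    (hint : ∀ n, Integrable (X n) μ)
    (hmean : ∀ n, ∫ ω, X n ω ∂μ = 1) :
    IsMartingaleSeq μ (partialProduct X) ∧
    (IsSubmartingaleSeq μ (maxStepDist X) ↔
      Integrable (fun ω => riemannDist 1 (X 0 ω)) μ) ∧
    (IsSubmartingaleSeq μ (maxWalkDist X) ↔
      Integrable (fun ω => riemannDist 1 (X 0 ω)) μ) ∧
    KolmogorovReducesToMarkov μ (maxStepDist X) ∧
    KolmogorovReducesToMarkov μ (maxWalkDist X) := by
  have hdist n := measurable_riemannDist_one (hmeas n) (hpos n)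
  have hwalk n := measurable_riemannDist_one
    (measurable_partialProduct hpos n fun j _ => hmeas j) (posDef_partialProduct hpos n)
  have hdistint := integrable_riemannDist_of_identDistrib hpos hident
  exact ⟨isMartingaleSeq_partialProduct hmeas hpos hindep hint hmean,
    isSubmartingaleSeq_runningMax_iff hdist (fun _ _ => riemannDist_nonneg _ _) hdistint,
    isSubmartingaleSeq_runningMax_iff hwalk (fun _ _ => riemannDist_nonneg _ _) fun h =>
      integrable_riemannDist_partialProduct hmeas hpos (hdistint h),
    kolmogorovReducesToMarkov_runningMax hdist fun _ _ => riemannDist_nonneg _ _,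
    kolmogorovReducesToMarkov_runningMax hwalk fun _ _ => riemannDist_nonneg _ _⟩
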